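/- All graphs are finite and simple. For integers $p\ge q\ge 1$ let $G_{p,q}$ be the graph on $\{0,\dots,p-1\}$ in which $u$ and $v$ are adjacent if and only if $q\le |u-v|\le p-q$; for $p\ge 2q$ it is called a circular clique. The circular chromatic number $\chi_c(G)$ of a graph $G$ is the minimum of $p/q$ over all integers $p\ge q\ge 1$ for which there is a graph homomorphism $G\to G_{p,q}$. For vertices $x,y$ of $G$ at distance $2$, the elementary fold of $x$ and $y$ is the quotient homomorphism $G\to G_{xy}$, where $G_{xy}$ is obtained from $G$ by identifying $x$ and $y$. A graph $G$ folds to a graph $H$ if some sequence of zero or more elementary folds, starting from $G$, ends in a graph isomorphic to $H$. **Theorem.** Let $p,q$ be positive integers with $p\ge 2q$. (i) If $q=1$ or $p=2q+1$, then every connected graph $G$ with $\chi_c(G)=p/q$ folds to $G_{p,q}$. (ii) Otherwise (that is, if $q\ne 1$ and $p\ne 2q+1$), there is a connected graph $G$ with $\chi_c(G)=p/q$ that does not fold to $G_{p,q}$. -/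

import Mathlib

universe u v

/-- The circular clique `G_{p,q}` on `{0, …, p-1}`: `a ~ b` iff `q ≤ |a - b| ≤ p - q`.
(The condition `a ≠ b` is automatic for `q ≥ 1`. For `q ≤ p < 2q` the graph has no edge.) -/
def circularClique (p q : ℕ) : SimpleGraph (Fin p) where
  Adj a b := a ≠ b ∧ (q : ℤ) ≤ |(a : ℤ) - (b : ℤ)| ∧ |(a : ℤ) - (b : ℤ)| ≤ (p : ℤ) - (q : ℤ)
  symm := ⟨fun a b h => by
    rw [abs_sub_comm (b : ℤ) (a : ℤ)]
    exact ⟨h.1.symm, h.2⟩⟩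
  loopless := ⟨fun _ h => h.1 rfl⟩

/-- `r` is the circular chromatic number of `G`: the minimum of `p / q` over the pairs of integers
`p ≥ q ≥ 1` such that `G` has a `(p,q)`-colouring, i.e. a homomorphism to `G_{p,q}`. -/
def IsCircularChromaticNumber {V : Type u} (G : SimpleGraph V) (r : ℚ) : Prop :=
  IsLeast {s : ℚ | ∃ p q : ℕ, 0 < q ∧ q ≤ p ∧ s = (p : ℚ) / (q : ℚ) ∧
    Nonempty (G →g circularClique p q)} r

/-- The equivalence relation that identifies `x` with `y` and nothing else. -/
def identifySetoid {V : Type u} (x y : V) : Setoid V where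
  r a b := a = b ∨ (a = x ∧ b = y) ∨ (a = y ∧ b = x)
  iseqv := ⟨fun _ => Or.inl rfl, by grind, by grind⟩

/-- The graph `G_{xy}` obtained from `G` by identifying the vertices `x` and `y`. -/
def identify {V : Type u} (G : SimpleGraph V) (x y : V) :
    SimpleGraph (Quotient (identifySetoid x y)) :=
  G.map (Quotient.mk (identifySetoid x y))

/-- The elementary fold `G → G_{xy}`, for vertices `x` and `y` at distance `2`. -/
def elementaryFold {V : Type u} (G : SimpleGraph V) (x y : V) (h : G.dist x y = 2) :
    G →g identify G x y :=
  SimpleGraph.Hom.map (Quotient.mk (identifySetoid x y)) G <| by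
    have hxy : ¬ G.Adj x y := fun hadj => by
      rw [SimpleGraph.dist_eq_one_iff_adj.mpr hadj] at h
      exact absurd h (by norm_num)
    intro a b hab heq
    rcases Quotient.exact heq with h1 | ⟨h1, h2⟩ | ⟨h1, h2⟩
    · exact hab.ne h1
    · exact hxy (h1 ▸ h2 ▸ hab)
    · exact hxy (h1 ▸ h2 ▸ hab.symm)

/-- A homomorphism `f : G → H` is a folding if it is a composition of (zero or more) elementary
folds, followed by an isomorphism of the resulting graph onto `H`. -/
inductive IsFolding {W : Type v} {H : SimpleGraph W} :
    {V : Type u} → {G : SimpleGraph V} → (G →g H) → Prop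
  | iso {V : Type u} {G : SimpleGraph V} (e : G ≃g H) : IsFolding e.toHom
  | comp {V : Type u} {G : SimpleGraph V} (x y : V) (h : G.dist x y = 2)
      (f : identify G x y →g H) (hf : IsFolding f) :
      IsFolding (f.comp (elementaryFold G x y h))

/-- `G` folds to `H`: there is a folding `G → H`. -/
def FoldsTo {V : Type u} {W : Type v} (G : SimpleGraph V) (H : SimpleGraph W) : Prop :=
  ∃ f : G →g H, IsFolding f

/-! For (i), whenever some homomorphism to the target gives two neighbours of a vertex the same
image, fold them; a homomorphism descends to the quotient. This ends at a connected graph all of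
whose homomorphisms to the target are locally injective, and which is still not (p-1)-colourable (if
q = 1) or not bipartite (if p = 2q+1). Modifying a homomorphism, by swapping colours across an edge
for complete graphs or by reflecting part of it for odd cycles, then forces that graph to be the
target (`nonempty_iso_top_of_locallyInjective`, `nonempty_iso_circulantGraph_of_locallyInjective`).

For (ii), every elementary fold loses a vertex. If p = 2q, the graph K₂ is too small to fold to the
target. If p ≥ 2q+2, deleting one suitable edge of the circular clique creates no independent set of
more than q vertices, so χ_c remains p/q (`isCircularChromaticNumber_of_indep`); with p vertices
already, no fold is available, and an edge is missing. -/

/-! ### Independent sets and lower bounds for χ_c -/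

theorem circularClique_adj_iff {p q : ℕ} (hq : 0 < q) {a b : Fin p} :
    (circularClique p q).Adj a b ↔
      ((a : ℕ) + q ≤ b ∧ (b : ℕ) + q ≤ a + p) ∨ ((b : ℕ) + q ≤ a ∧ (a : ℕ) + q ≤ b + p) := by
  have : (a = b) ↔ ((a : ℕ) = b) := Fin.ext_iff
  simp only [circularClique, ne_eq, this]
  rcases abs_cases ((a : ℤ) - (b : ℤ)) with ⟨h, h'⟩ | ⟨h, h'⟩ <;> rw [h] <;> omega

theorem circularClique_adj_of_le {p q : ℕ} (hq : 0 < q) {a b : Fin p} (h1 : (a : ℕ) + q ≤ b)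
    (h2 : (b : ℕ) + q ≤ a + p) : (circularClique p q).Adj a b :=
  (circularClique_adj_iff hq).2 (Or.inl ⟨h1, h2⟩)

open Classical in
/-- An `(a,b)`-colouring of a graph on `n` vertices without independent sets of more than `k`
vertices forces `n b ≤ a k`. -/
theorem card_mul_le_of_hom_circularClique {V : Type*} [Fintype V] {G : SimpleGraph V} {k : ℕ}
    (hk : ∀ s : Finset V, G.IsIndepSet s → s.card ≤ k) {a b : ℕ} (hb : 0 < b) (hba : b ≤ a)
    (c : G →g circularClique a b) : Fintype.card V * b ≤ a * k := by
  -- Double count the pairs (x, i) with i in the cyclic arc of length b starting at c x. Arcs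
  -- through a common i start less than b apart, so their vertices are independent.
  have key := Finset.sum_card_bipartiteAbove_eq_sum_card_bipartiteBelow
    (s := (Finset.univ : Finset V)) (t := (Finset.univ : Finset (Fin a)))
    (fun (x : V) (i : Fin a) => ∃ t : Fin b, ((c x : ℕ) + t) % a = (i : ℕ))
  have h1 : ∀ x : V, ((Finset.univ : Finset (Fin a)).bipartiteAbove
      (fun (x : V) (i : Fin a) => ∃ t : Fin b, ((c x : ℕ) + t) % a = (i : ℕ)) x).card = b := by
    intro x
    have hinj : Function.Injective
        (fun t : Fin b => (⟨((c x : ℕ) + t) % a, Nat.mod_lt _ (by omega)⟩ : Fin a)) := by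
      intro t t' h
      simp only [Fin.mk.injEq] at h
      have h2 : (t : ℕ) ≡ t' [MOD a] := Nat.ModEq.add_left_cancel' _ h
      exact Fin.ext (h2.eq_of_lt_of_lt (by omega) (by omega))
    have h3 := Finset.card_image_of_injective Finset.univ hinj
    rw [Finset.card_univ, Fintype.card_fin] at h3
    refine Eq.trans (congrArg _ ?_) h3
    ext i
    simp [Finset.bipartiteAbove, Fin.ext_iff]
  have h2 : ∀ i : Fin a, ((Finset.univ : Finset V).bipartiteBelow
      (fun (x : V) (i : Fin a) => ∃ t : Fin b, ((c x : ℕ) + t) % a = (i : ℕ)) i).card ≤ k := by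
    intro i
    apply hk
    intro x hx y hy hxy hadj
    simp only [Finset.bipartiteBelow, Finset.coe_filter, Finset.mem_univ, true_and,
      Set.mem_ofPred_eq] at hx hy
    obtain ⟨t, ht⟩ := hx
    obtain ⟨t', ht'⟩ := hy
    have h3 := (circularClique_adj_iff hb).1 (c.map_adj hadj)
    have e1 := Nat.div_add_mod ((c x : ℕ) + t) a
    have e2 := Nat.div_add_mod ((c y : ℕ) + t') a
    have := (c x).2
    have := (c y).2
    have := t.2
    have := t'.2
    have l1 : ((c x : ℕ) + t) / a < 2 := by
      rw [Nat.div_lt_iff_lt_mul (by omega)]; omega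
    have l2 : ((c y : ℕ) + t') / a < 2 := by
      rw [Nat.div_lt_iff_lt_mul (by omega)]; omega
    rw [ht] at e1
    rw [ht'] at e2
    generalize ((c x : ℕ) + t) / a = d at *
    generalize ((c y : ℕ) + t') / a = d' at *
    interval_cases d <;> interval_cases d' <;> omega
  simp only [h1, Finset.sum_const, Finset.card_univ, smul_eq_mul] at key
  rw [key]
  calc _ ≤ ∑ _i : Fin a, k := Finset.sum_le_sum fun i _ => h2 i
    _ = a * k := by simp

theorem isCircularChromaticNumber_of_indep {V : Type u} [Fintype V] {G : SimpleGraph V} {p q : ℕ}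
    (hq : 0 < q) (hqp : q ≤ p) (c : G →g circularClique p q) (hV : Fintype.card V = p)
    (hk : ∀ s : Finset V, G.IsIndepSet s → s.card ≤ q) :
    IsCircularChromaticNumber G ((p : ℚ) / q) := by
  refine ⟨⟨p, q, hq, hqp, rfl, ⟨c⟩⟩, ?_⟩
  rintro _ ⟨a, b, hb, hba, rfl, ⟨c'⟩⟩
  have h := card_mul_le_of_hom_circularClique hk hb hba c'
  rw [hV] at h
  rw [div_le_div_iff₀ (by positivity) (by positivity)]
  exact_mod_cast h

/-! ### Folds and vertex counts -/

theorem card_identify_lt {V : Type u} [Finite V] {x y : V} (hxy : x ≠ y) :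
    Nat.card (Quotient (identifySetoid x y)) < Nat.card V := by
  refine lt_of_le_of_ne (Nat.card_le_card_of_surjective _ Quotient.mk_surjective) fun h => ?_
  have hb := (Nat.bijective_iff_surjective_and_card (Quotient.mk (identifySetoid x y))).2
    ⟨Quotient.mk_surjective, h.symm⟩
  exact hxy (hb.1 (Quotient.sound (Or.inr (Or.inl ⟨rfl, rfl⟩))))

theorem IsFolding.card_lt_or_iso {W : Type v} {H : SimpleGraph W} {V : Type u}
    {G : SimpleGraph V} {f : G →g H} (hf : IsFolding f) :
    Finite V → Nat.card W < Nat.card V ∨ Nonempty (G ≃g H) := by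
  induction hf with
  | iso e => exact fun _ => Or.inr ⟨e⟩
  | comp x y h f hf ih =>
    intro hV
    have hxy : x ≠ y := by rintro rfl; simp at h
    left
    rcases ih inferInstance with h1 | ⟨⟨e⟩⟩
    · exact h1.trans (card_identify_lt hxy)
    · rw [← Nat.card_congr e.toEquiv]
      exact card_identify_lt hxy

/-! ### Counterexamples for (ii) -/

/-- The circular clique with the edge `{0, q + 1}` removed. -/
def cutCircularClique (p q : ℕ) : SimpleGraph (Fin p) where
  Adj a b := (circularClique p q).Adj a b ∧
    ¬ (((a : ℕ) = 0 ∧ (b : ℕ) = q + 1) ∨ ((b : ℕ) = 0 ∧ (a : ℕ) = q + 1))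
  symm := ⟨fun _ _ h => ⟨h.1.symm, fun h' => h.2 h'.symm⟩⟩
  loopless := ⟨fun _ h => h.1.1 rfl⟩

theorem cutCircularClique_connected {p q : ℕ} (hq : 0 < q) (hpq : 2 * q + 2 ≤ p) :
    (cutCircularClique p q).Connected := by
  have step : ∀ v : ℕ, ∀ h : v + 1 < p,
      (cutCircularClique p q).Reachable ⟨v, by omega⟩ ⟨v + 1, h⟩ := by
    intro v h
    have via : ∀ w : Fin p, (cutCircularClique p q).Adj ⟨v, by omega⟩ w →
        (cutCircularClique p q).Adj w ⟨v + 1, h⟩ →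
        (cutCircularClique p q).Reachable ⟨v, by omega⟩ ⟨v + 1, h⟩ :=
      fun w h1 h2 => h1.reachable.trans h2.reachable
    -- The natural common neighbour v+q+1 of v and v+1 fails at v = 0, where it uses the deleted
    -- edge, and near p, where it is out of range.
    by_cases h0 : v = 0
    · refine via ⟨p - q, by omega⟩ ⟨circularClique_adj_of_le hq ?_ ?_, ?_⟩
        ⟨(circularClique_adj_of_le hq ?_ ?_).symm, ?_⟩ <;> simp only <;> omega
    by_cases h1 : v + q + 2 ≤ p
    · refine via ⟨v + q + 1, by omega⟩ ⟨circularClique_adj_of_le hq ?_ ?_, ?_⟩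
        ⟨(circularClique_adj_of_le hq ?_ ?_).symm, ?_⟩ <;> simp only <;> omega
    · refine via ⟨v - q, by omega⟩ ⟨(circularClique_adj_of_le hq ?_ ?_).symm, ?_⟩
        ⟨circularClique_adj_of_le hq ?_ ?_, ?_⟩ <;> simp only <;> omega
  have all : ∀ v : ℕ, ∀ h : v < p,
      (cutCircularClique p q).Reachable ⟨0, by omega⟩ ⟨v, h⟩ := by
    intro v
    induction v with
    | zero => exact fun _ => SimpleGraph.Reachable.refl _
    | succ v ih => exact fun h => (ih (by omega)).trans (step v h)
  have : Nonempty (Fin p) := ⟨⟨0, by omega⟩⟩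
  exact ⟨fun a b => (all a a.2).symm.trans (all b b.2)⟩

theorem circularClique_card_le_of_isIndepSet {p q : ℕ} (hq : 0 < q) (hpq : 2 * q ≤ p)
    {s : Finset (Fin p)} (hs : (circularClique p q).IsIndepSet s) : s.card ≤ q := by
  rcases s.eq_empty_or_nonempty with rfl | hne
  · simp
  obtain ⟨x, hx, hmin⟩ := s.exists_min_image (fun y : Fin p => (y : ℕ)) hne
  have nadj : ∀ a ∈ s, ∀ b ∈ s, ¬ (((a : ℕ) + q ≤ b ∧ (b : ℕ) + q ≤ a + p) ∨
      ((b : ℕ) + q ≤ a ∧ (a : ℕ) + q ≤ b + p)) := by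
    intro a ha b hb h
    have h' := (circularClique_adj_iff hq).2 h
    exact hs ha hb h'.ne h'
  rw [← Finset.card_range q]
  -- Offsets from the least element x are below q or above p-q; the latter are lowered by p-q. A
  -- collision would give two elements p-q apart, hence adjacent.
  refine Finset.card_le_card_of_injOn
    (fun y => if (y : ℕ) < x + q then (y : ℕ) - x else y + q - x - p) ?_ ?_
  · intro y hy
    have := hmin y hy
    have := nadj x hx y hy
    have := y.2
    simp only [Finset.coe_range, Set.mem_Iio]
    split_ifs <;> omega
  · intro y hy z hz h
    have := hmin y hy
    have := hmin z hz
    have := nadj x hx y hy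
    have := nadj x hx z hz
    have := nadj y hy z hz
    have := y.2
    have := z.2
    simp only at h
    apply Fin.ext
    split_ifs at h <;> omega

theorem cutCircularClique_card_le_of_isIndepSet {p q : ℕ} (hq : 2 ≤ q) (hpq : 2 * q + 2 ≤ p)
    {s : Finset (Fin p)} (hs : (cutCircularClique p q).IsIndepSet s) : s.card ≤ q := by
  by_cases hcut : (⟨0, by omega⟩ : Fin p) ∈ s ∧ (⟨q + 1, by omega⟩ : Fin p) ∈ s
  · have nadj : ∀ a ∈ s, ∀ b ∈ s, ¬ (((a : ℕ) + q ≤ b ∧ (b : ℕ) + q ≤ a + p) ∧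
        ¬ ((a : ℕ) = 0 ∧ (b : ℕ) = q + 1)) := by
      intro a ha b hb h
      have h' : (cutCircularClique p q).Adj a b :=
        ⟨circularClique_adj_of_le (by omega) h.1.1 h.1.2, by omega⟩
      exact hs ha hb h'.ne h'
    have bound : ∀ y ∈ s, (y : ℕ) = 0 ∨ (y : ℕ) = q + 1 ∨ (2 ≤ (y : ℕ) ∧ (y : ℕ) < q) ∨
        (p < (y : ℕ) + q ∧ (y : ℕ) ≤ 2 * q) := by
      intro y hy
      have := y.2
      have h1 := nadj _ hcut.1 y hy
      have h2 := nadj _ hcut.2 y hy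
      have h3 := nadj y hy _ hcut.2
      simp only at h1 h2 h3
      omega
    rw [← Finset.card_range q]
    -- The values 0 and 1 go to the vertices 0 and q+1; this is where q ≥ 2 is needed. Other
    -- collisions are pairs y, y+q+1 with y ≥ 2, which are still adjacent.
    refine Finset.card_le_card_of_injOn
      (fun y => if (y : ℕ) = q + 1 then 1 else if (y : ℕ) < q then (y : ℕ) else y - (q + 1)) ?_ ?_
    · intro y hy
      have := bound y hy
      simp only [Finset.coe_range, Set.mem_Iio]
      split_ifs <;> omega
    · intro y hy z hz h
      have := bound y hy
      have := bound z hz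
      have := nadj y hy z hz
      have := nadj z hz y hy
      simp only at h
      apply Fin.ext
      split_ifs at h <;> omega
  · refine circularClique_card_le_of_isIndepSet (by omega) (by omega)
      fun a ha b hb hab h => hs ha hb hab ⟨h, ?_⟩
    rintro (⟨h1, h2⟩ | ⟨h1, h2⟩)
    · have e1 : (⟨0, by omega⟩ : Fin p) = a := Fin.ext h1.symm
      have e2 : (⟨q + 1, by omega⟩ : Fin p) = b := Fin.ext h2.symm
      exact hcut ⟨e1 ▸ ha, e2 ▸ hb⟩
    · have e1 : (⟨0, by omega⟩ : Fin p) = b := Fin.ext h1.symm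
      have e2 : (⟨q + 1, by omega⟩ : Fin p) = a := Fin.ext h2.symm
      exact hcut ⟨e1 ▸ hb, e2 ▸ ha⟩

theorem cutCircularClique_not_iso {p q : ℕ} (hq : 0 < q) (hpq : 2 * q + 2 ≤ p) :
    IsEmpty (cutCircularClique p q ≃g circularClique p q) := by
  classical
  refine ⟨fun e => ?_⟩
  have hle : cutCircularClique p q ≤ circularClique p q := fun _ _ h => h.1
  have heq := SimpleGraph.edgeFinset_inj.1
    (Finset.eq_of_subset_of_card_le (SimpleGraph.edgeFinset_mono hle) e.card_edgeFinset_eq.ge)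
  have h : (circularClique p q).Adj ⟨0, by omega⟩ ⟨q + 1, by omega⟩ :=
    circularClique_adj_of_le hq (by simp only; omega) (by simp only; omega)
  rw [← heq] at h
  exact h.2 (Or.inl ⟨rfl, rfl⟩)

theorem exists_connected_not_foldsTo {p q : ℕ} (hq : 2 ≤ q) (hpq : 2 * q ≤ p)
    (hne : p ≠ 2 * q + 1) :
    ∃ (n : ℕ) (G : SimpleGraph (Fin n)), G.Connected ∧
      IsCircularChromaticNumber G ((p : ℚ) / (q : ℚ)) ∧ ¬ FoldsTo G (circularClique p q) := by
  rcases hpq.eq_or_lt with rfl | hlt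
  · refine ⟨2, circularClique 2 1, ?_, ?_, ?_⟩
    · have h : (circularClique 2 1).Adj 0 1 := circularClique_adj_of_le one_pos (by simp) (by simp)
      refine ⟨fun a b => ?_⟩
      fin_cases a <;> fin_cases b
      exacts [SimpleGraph.Reachable.refl _, h.reachable, h.symm.reachable,
        SimpleGraph.Reachable.refl _]
    · have h := isCircularChromaticNumber_of_indep one_pos one_le_two
        (SimpleGraph.Hom.id (G := circularClique 2 1)) (by simp)
        fun s hs => circularClique_card_le_of_isIndepSet one_pos (by simp) hs
      convert h using 1
      have : (q : ℚ) ≠ 0 := by positivity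
      push_cast
      field_simp
    · rintro ⟨f, hf⟩
      rcases hf.card_lt_or_iso inferInstance with h | ⟨⟨e⟩⟩
      · simp only [Nat.card_fin] at h
        omega
      · have h := Nat.card_congr e.toEquiv
        simp only [Nat.card_fin] at h
        omega
  · refine ⟨p, cutCircularClique p q, cutCircularClique_connected (by omega) (by omega),
      isCircularChromaticNumber_of_indep (by omega) (by omega) ⟨id, fun h => h.1⟩ (by simp)
        fun s hs => cutCircularClique_card_le_of_isIndepSet hq (by omega) hs, ?_⟩
    rintro ⟨f, hf⟩
    rcases hf.card_lt_or_iso inferInstance with h | ⟨⟨e⟩⟩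
    · exact h.ne rfl
    · exact (cutCircularClique_not_iso (by omega) (by omega)).false e

/-! ### Reduction to locally injective homomorphisms -/

theorem dist_eq_two {V : Type u} {G : SimpleGraph V} {x y z : V} (hx : G.Adj z x) (hy : G.Adj z y)
    (hne : x ≠ y) (hxy : ¬ G.Adj x y) : G.dist x y = 2 := by
  have h1 : G.dist x y ≤ 2 := by
    simpa using SimpleGraph.dist_le (hx.symm.toWalk.append hy.toWalk)
  have hr : G.Reachable x y := hx.symm.reachable.trans hy.reachable
  have h0 : G.dist x y ≠ 0 := fun h => hne (hr.dist_eq_zero_iff.1 h)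
  have h2 : G.dist x y ≠ 1 := fun h => hxy (SimpleGraph.dist_eq_one_iff_adj.1 h)
  omega

theorem identify_connected {V : Type u} {G : SimpleGraph V} (hG : G.Connected) {x y : V}
    (h : G.dist x y = 2) : (identify G x y).Connected :=
  hG.map (elementaryFold G x y h) Quotient.mk_surjective

theorem identify_lift {V : Type u} {W : Type v} {G : SimpleGraph V} {H : SimpleGraph W}
    (f : G →g H) {x y : V} (h : f x = f y) : Nonempty (identify G x y →g H) := by
  refine ⟨⟨Quotient.lift f ?_, ?_⟩⟩
  · rintro a b (rfl | ⟨rfl, rfl⟩ | ⟨rfl, rfl⟩)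
    exacts [rfl, h, h.symm]
  · rintro _ _ ⟨hab, a, b, hadj, rfl, rfl⟩
    exact f.map_adj hadj

/-- If every connected graph `G` that maps to `H`, is not `k`-colourable, and has only locally
injective homomorphisms to `H`, is isomorphic to `H`, then all connected graphs that map to `H` and
are not `k`-colourable fold to `H`. -/
theorem foldsTo_of_locallyInjective_imp_iso {W : Type v} {H : SimpleGraph W} {k : ℕ}
    (hiso : ∀ (V : Type u) [Finite V] (G : SimpleGraph V), G.Connected → ∀ _ : G →g H,
      ¬ G.Colorable k →
      (∀ (f : G →g H) (x y z : V), G.Adj z x → G.Adj z y → f x = f y → x = y) →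
      Nonempty (G ≃g H))
    (V : Type u) [Finite V] (G : SimpleGraph V) (hG : G.Connected) (f : G →g H)
    (hk : ¬ G.Colorable k) : FoldsTo G H := by
  induction hn : Nat.card V using Nat.strong_induction_on generalizing V with
  | _ n ih =>
    by_cases hinj : ∀ (f : G →g H) (x y z : V), G.Adj z x → G.Adj z y → f x = f y → x = y
    · obtain ⟨e⟩ := hiso V G hG f hk hinj
      exact ⟨_, IsFolding.iso e⟩
    · push Not at hinj
      obtain ⟨f, x, y, z, hx, hy, hf, hne⟩ := hinj
      have hd := dist_eq_two hx hy hne fun h => (f.map_adj h).ne hf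
      obtain ⟨f'⟩ := identify_lift f hf
      obtain ⟨g, hg⟩ := ih _ (hn ▸ card_identify_lt hne) _ (identify G x y)
        (identify_connected hG hd) f'
        (fun h => hk (h.of_hom (elementaryFold G x y hd))) rfl
      exact ⟨_, IsFolding.comp x y hd g hg⟩

theorem mem_of_connected_of_adj_closed {V : Type*} {G : SimpleGraph V} (hG : G.Connected)
    {P : V → Prop} (hP : ∀ a b, G.Adj a b → P a → P b) {a : V} (ha : P a) (b : V) : P b := by
  obtain ⟨w⟩ := hG a b
  induction w with
  | nil => exact ha
  | cons h _ ih => exact ih (hP _ _ h ha)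

/-! ### Complete graphs -/

theorem circularClique_one (n : ℕ) : circularClique n 1 = ⊤ := by
  ext a b
  rw [circularClique_adj_iff one_pos, SimpleGraph.top_adj, ne_eq, Fin.ext_iff]
  omega

theorem surjective_of_not_colorable {V : Type*} {G : SimpleGraph V} {k : ℕ}
    (hk : ¬ G.Colorable k) (c : G →g (⊤ : SimpleGraph (Fin (k + 1)))) : Function.Surjective c := by
  intro i
  by_contra! h
  refine hk ⟨⟨fun v => (finSuccAboveEquiv i).symm ⟨c v, h v⟩, fun {a b} hab heq => ?_⟩⟩
  have := (finSuccAboveEquiv i).symm.injective heq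
  exact (c.map_adj hab).ne (congrArg Subtype.val this)

/-- Local injectivity makes the neighbours of a vertex differently coloured, so swapping the colours
of two adjacent vertices stays proper. Such swaps carry the last colour, in a colouring using it
least, to any vertex; a vertex so coloured sees all other colours. -/
theorem nonempty_iso_top_of_locallyInjective {V : Type*} [Finite V] {G : SimpleGraph V}
    (hG : G.Connected) {k : ℕ} (c₀ : G →g (⊤ : SimpleGraph (Fin (k + 1)))) (hk : ¬ G.Colorable k)
    (hinj : ∀ (c : G →g (⊤ : SimpleGraph (Fin (k + 1)))) (x y z : V),
      G.Adj z x → G.Adj z y → c x = c y → x = y) :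
    Nonempty (G ≃g (⊤ : SimpleGraph (Fin (k + 1)))) := by
  classical
  have _ := Fintype.ofFinite V
  have hswap : ∀ (c : G →g (⊤ : SimpleGraph (Fin (k + 1)))) (v w : V), G.Adj v w →
      ∃ c' : G →g (⊤ : SimpleGraph (Fin (k + 1))), ∀ x, c' x = c (Equiv.swap v w x) := by
    intro c v w hvw
    refine ⟨⟨fun x => c (Equiv.swap v w x), fun {a b} hab => ?_⟩, fun _ => rfl⟩
    have key : ∀ v w a b : V, G.Adj v w → G.Adj a b → a = v → b ≠ v → b ≠ w → c w ≠ c b := by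
      rintro v w _ b hvw hab rfl - hb h
      exact hb (hinj c _ _ _ hvw hab h).symm
    have hne := hab.ne
    rw [SimpleGraph.top_adj]
    rcases eq_or_ne a v with rfl | hav
    · rcases eq_or_ne b w with rfl | hbw
      · simpa using (c.map_adj hvw).ne.symm
      · rw [Equiv.swap_apply_left, Equiv.swap_apply_of_ne_of_ne hne.symm hbw]
        exact key _ _ _ _ hvw hab rfl hne.symm hbw
    rcases eq_or_ne a w with rfl | haw
    · rcases eq_or_ne b v with rfl | hbv
      · simpa using (c.map_adj hvw).ne
      · rw [Equiv.swap_apply_right, Equiv.swap_apply_of_ne_of_ne hbv hne.symm]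
        exact key _ _ _ _ hvw.symm hab rfl hne.symm hbv
    rw [Equiv.swap_apply_of_ne_of_ne hav haw]
    rcases eq_or_ne b v with rfl | hbv
    · rw [Equiv.swap_apply_left]
      exact (key _ _ _ _ hvw hab.symm rfl hav haw).symm
    rcases eq_or_ne b w with rfl | hbw
    · rw [Equiv.swap_apply_right]
      exact (key _ _ _ _ hvw.symm hab.symm rfl haw hav).symm
    · rw [Equiv.swap_apply_of_ne_of_ne hbv hbw]
      exact (c.map_adj hab).ne
  let sz : (G →g (⊤ : SimpleGraph (Fin (k + 1)))) → ℕ := fun c =>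
    (Finset.univ.filter fun v => c v = Fin.last k).card
  have hfin : ∃ c, ∀ c', sz c ≤ sz c' := by
    have : Nonempty (G →g (⊤ : SimpleGraph (Fin (k + 1)))) := ⟨c₀⟩
    exact ⟨Function.argmin sz, fun c' => Function.argmin_le sz c'⟩
  obtain ⟨c₁, hc₁⟩ := hfin
  have hmin : ∀ v : V, ∃ c, sz c = sz c₁ ∧ c v = Fin.last k := by
    obtain ⟨v₀, hv₀⟩ := surjective_of_not_colorable hk c₁ (Fin.last k)
    refine mem_of_connected_of_adj_closed hG ?_ ⟨c₁, rfl, hv₀⟩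
    rintro v w hvw ⟨c, hc, hcv⟩
    obtain ⟨c', hc'⟩ := hswap c v w hvw
    refine ⟨c', ?_, by simpa [hc'] using hcv⟩
    rw [← hc]
    refine Finset.card_equiv (Equiv.swap v w) fun x => ?_
    simp [hc']
  have hrain : ∀ (c : G →g (⊤ : SimpleGraph (Fin (k + 1)))) (v : V), sz c = sz c₁ →
      c v = Fin.last k → ∀ j, j ≠ Fin.last k → ∃ w, G.Adj v w ∧ c w = j := by
    intro c v hc hv j hj
    by_contra! h
    -- If v missed the colour j, recolouring v with j would shrink the minimal last class.
    let c' : G →g (⊤ : SimpleGraph (Fin (k + 1))) := ⟨Function.update c v j, by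
      intro a b hab
      have hne := hab.ne
      rw [SimpleGraph.top_adj]
      rcases eq_or_ne a v with rfl | hav
      · rw [Function.update_self, Function.update_of_ne hne.symm]
        exact (h b hab).symm
      rw [Function.update_of_ne hav]
      rcases eq_or_ne b v with rfl | hbv
      · rw [Function.update_self]
        exact h a hab.symm
      · rw [Function.update_of_ne hbv]
        exact (c.map_adj hab).ne⟩
    have hlt : sz c' < sz c := by
      refine Finset.card_lt_card (Finset.ssubset_iff_of_subset ?_ |>.2 ⟨v, ?_, ?_⟩)
      · intro x hx
        rcases eq_or_ne x v with rfl | hxv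
        · simpa using hv
        · simpa [c', hxv] using hx
      · simpa using hv
      · simpa [c'] using hj
    exact absurd (hc₁ c') (by omega)
  have htri : ∀ v x y, G.Adj v x → G.Adj v y → x ≠ y → G.Adj x y := by
    intro v x y hx hy hxy
    by_contra hn
    obtain ⟨c, hc, hcx⟩ := hmin x
    have hcy : c y ≠ Fin.last k := fun h => hxy (hinj c _ _ _ hx hy (hcx.trans h.symm))
    obtain ⟨u, hxu, hu⟩ := hrain c x hc hcx _ hcy
    -- The swap gives x the colour of y, contradicting local injectivity at v.
    obtain ⟨c', hc'⟩ := hswap c x u hxu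
    have hyu : y ≠ u := fun h => hn (h ▸ hxu)
    refine hxy (hinj c' _ _ _ hx hy ?_)
    rw [hc', hc', Equiv.swap_apply_left, Equiv.swap_apply_of_ne_of_ne hxy.symm hyu, hu]
  have hcomplete : ∀ a b, a ≠ b → G.Adj a b := by
    intro a b
    refine mem_of_connected_of_adj_closed hG (P := fun b => a ≠ b → G.Adj a b) ?_
      (fun h => absurd rfl h) b
    intro x y hxy hax hay
    rcases eq_or_ne a x with rfl | h
    · exact hxy
    · exact htri x a y (hax h).symm hxy hay
  have hbij : Function.Bijective c₁ :=
    ⟨fun a b h => by_contra fun hab => (c₁.map_adj (hcomplete a b hab)).ne h,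
      surjective_of_not_colorable hk c₁⟩
  exact ⟨⟨Equiv.ofBijective c₁ hbij, fun {a b} =>
    ⟨fun h => hcomplete a b fun e => h.ne (e ▸ rfl), fun h => c₁.map_adj h⟩⟩⟩

/-! ### Odd cycles -/

theorem circulantGraph_one_adj {m : ℕ} [Fact (1 < m)] {a b : ZMod m} :
    (SimpleGraph.circulantGraph ({1} : Set (ZMod m))).Adj a b ↔ b = a + 1 ∨ a = b + 1 := by
  rw [SimpleGraph.circulantGraph_adj]
  simp only [Set.mem_singleton_iff, sub_eq_iff_eq_add, add_comm (1 : ZMod m)]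
  constructor
  · rintro ⟨-, h | h⟩
    exacts [Or.inr h, Or.inl h]
  · rintro (rfl | rfl) <;> simp

/-- A connected graph that is not bipartite and has only locally injective homomorphisms to the
cycle on `ℤ/m` has a second neighbour next to each neighbour of each vertex. -/
theorem exists_ne_adj_of_locallyInjective {V : Type*} {G : SimpleGraph V}
    (hG : G.Connected) {m : ℕ} [Fact (1 < m)]
    (f : G →g SimpleGraph.circulantGraph ({1} : Set (ZMod m))) (hk : ¬ G.Colorable 2)
    (hinj : ∀ (f : G →g SimpleGraph.circulantGraph ({1} : Set (ZMod m))) (x y z : V),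
      G.Adj z x → G.Adj z y → f x = f y → x = y) {v w : V} (hvw : G.Adj v w) :
    ∃ u, u ≠ w ∧ G.Adj v u := by
  classical
  by_contra! h
  have hv : ∀ u, G.Adj v u → u = w := fun u hu => by_contra fun huw => h u huw hu
  -- If w is the only neighbour of v, the image of v may be reflected about f w. It would then meet
  -- the image of any other neighbour of w, so G would be a single edge.
  let f' : G →g SimpleGraph.circulantGraph ({1} : Set (ZMod m)) :=
    ⟨Function.update f v (2 * f w - f v), by
      have hadj := circulantGraph_one_adj.1 (f.map_adj hvw)
      have key : (SimpleGraph.circulantGraph ({1} : Set (ZMod m))).Adj (2 * f w - f v) (f w) := by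
        rw [circulantGraph_one_adj]
        grind
      intro a b hab
      have hne := hab.ne
      rcases eq_or_ne a v with rfl | hav
      · rw [Function.update_self, Function.update_of_ne hne.symm, hv b hab]
        exact key
      rw [Function.update_of_ne hav]
      rcases eq_or_ne b v with rfl | hbv
      · rw [Function.update_self, hv a hab.symm]
        exact key.symm
      · rw [Function.update_of_ne hbv]
        exact f.map_adj hab⟩
  have hw : ∀ u, G.Adj w u → u = v := by
    intro u hu
    by_contra huv
    have h1 := circulantGraph_one_adj.1 (f.map_adj hvw)
    have h2 := circulantGraph_one_adj.1 (f.map_adj hu)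
    have h3 : f u ≠ f v := fun e => huv (hinj f _ _ _ hu hvw.symm e)
    refine huv (hinj f' _ _ _ hu hvw.symm ?_)
    change Function.update f v _ u = Function.update f v _ v
    rw [Function.update_self, Function.update_of_ne huv]
    grind
  have hall : ∀ b, b = v ∨ b = w := by
    refine mem_of_connected_of_adj_closed hG ?_ (Or.inl rfl : v = v ∨ v = w)
    rintro a b hab (rfl | rfl)
    exacts [Or.inr (hv b hab), Or.inl (hw b hab)]
  refine hk ⟨⟨fun x => if x = v then 0 else 1, fun {a b} hab => ?_⟩⟩
  have hne := hab.ne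
  have := hvw.ne
  have := hvw.ne'
  rcases hall a with rfl | rfl <;> rcases hall b with rfl | rfl <;> simp_all

theorem exists_adj_of_not_colorable {V : Type*} {G : SimpleGraph V} (hG : G.Connected)
    (hk : ¬ G.Colorable 2) (v : V) : ∃ w, G.Adj v w := by
  by_contra! h
  have hall : ∀ b, b = v :=
    mem_of_connected_of_adj_closed hG (fun a b hab ha => absurd (ha ▸ hab) (h b)) rfl
  exact hk ⟨⟨fun _ => 0, fun {a b} hab => absurd ((hall a).trans (hall b).symm) hab.ne⟩⟩

/-- A surjective successor map compatible with a locally injective homomorphism to the cycle on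
`ℤ/m` has period `m`. -/
theorem iterate_eq_self_of_locallyInjective {V : Type*} {G : SimpleGraph V} {m : ℕ} (hm : 3 ≤ m)
    [Fact (1 < m)] (f : G →g SimpleGraph.circulantGraph ({1} : Set (ZMod m)))
    (hinj : ∀ (f : G →g SimpleGraph.circulantGraph ({1} : Set (ZMod m))) (x y z : V),
      G.Adj z x → G.Adj z y → f x = f y → x = y)
    {s : V → V} (hs : ∀ v, G.Adj v (s v)) (hfs : ∀ v, f (s v) = f v + 1)
    (hadj : ∀ a b, G.Adj a b → b = s a ∨ a = s b) (hsurj : Function.Surjective s) (v : V) :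
    s^[m] v = v := by
  classical
  have hsinj : Function.Injective s := fun a b h =>
    hinj f a b (s a) (hs a).symm (h ▸ (hs b).symm) (by
      have h1 := hfs a
      rw [h, hfs b] at h1
      exact (add_right_cancel h1).symm)
  have hfi : ∀ i, f (s^[i] v) = f v + i := by
    intro i
    induction i with
    | zero => simp
    | succ i ih => rw [Function.iterate_succ_apply', hfs, ih]; push_cast; ring
  -- Reflect f about f v along the stretch from v to its m-th successor; both ends have image f v,
  -- so the result is a homomorphism. If the predecessor u of v were off the stretch, u and s v
  -- would get the same image.
  let S : Set V := {x | ∃ i ≤ m, x = s^[i] v}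
  let g : V → ZMod m := fun x => if x ∈ S then 2 * f v - f x else f x
  have hg1 : ∀ x ∈ S, g x = 2 * f v - f x := fun x hx => if_pos hx
  have hg2 : ∀ x ∉ S, g x = f x := fun x hx => if_neg hx
  have hstep : ∀ a, (SimpleGraph.circulantGraph ({1} : Set (ZMod m))).Adj (g a) (g (s a)) := by
    intro a
    rw [circulantGraph_one_adj]
    by_cases ha : a ∈ S <;> by_cases hsa : s a ∈ S
    · rw [hg1 _ ha, hg1 _ hsa, hfs]
      right; ring
    · rw [hg1 _ ha, hg2 _ hsa, hfs]
      obtain ⟨i, hi, rfl⟩ := ha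
      have him : i = m := by
        by_contra hne
        exact hsa ⟨i + 1, by omega, by rw [Function.iterate_succ_apply']⟩
      subst him
      rw [hfi, ZMod.natCast_self]
      left; ring
    · rw [hg2 _ ha, hg1 _ hsa]
      obtain ⟨i, hi, h⟩ := hsa
      cases i with
      | zero =>
        have hfa := hfs a
        rw [show s a = v from h] at hfa ⊢
        rw [hfa]
        left; ring
      | succ j =>
        rw [Function.iterate_succ_apply'] at h
        exact absurd ⟨j, by omega, hsinj h⟩ ha
    · rw [hg2 _ ha, hg2 _ hsa, hfs]
      exact Or.inl rfl
  let f' : G →g SimpleGraph.circulantGraph ({1} : Set (ZMod m)) := ⟨g, fun {a b} hab => by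
    rcases hadj a b hab with rfl | rfl
    exacts [hstep a, (hstep b).symm]⟩
  obtain ⟨u, hu⟩ := hsurj v
  have hfu : f v = f u + 1 := by rw [← hfs, hu]
  have hsv : s v ∈ S := ⟨1, by omega, rfl⟩
  have huS : u ∈ S := by
    by_contra huS
    have : u = s v := by
      refine hinj f' u (s v) v (hu ▸ (hs u).symm) (hs v) ?_
      change g u = g (s v)
      rw [hg2 _ huS, hg1 _ hsv, hfs, hfu]
      ring
    exact huS (this ▸ hsv)
  obtain ⟨i, hi, rfl⟩ := huS
  have hdvd : m ∣ i + 1 := by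
    rw [← ZMod.natCast_eq_zero_iff]
    rw [hfi] at hfu
    push_cast
    linear_combination -hfu
  obtain ⟨d, hd⟩ := hdvd
  -- Here 0 < i+1 ≤ m+1 < 2m.
  have hd1 : d = 1 := by
    have : d < 2 := by
      by_contra hd2
      have : m * 2 ≤ m * d := Nat.mul_le_mul_left m (by omega)
      omega
    have : d ≠ 0 := by rintro rfl; omega
    omega
  rw [hd1, mul_one] at hd
  rw [← hd, Function.iterate_succ_apply', hu]

theorem nonempty_iso_circulantGraph_of_locallyInjective {V : Type*} {G : SimpleGraph V}
    (hG : G.Connected) {m : ℕ} (hm : 3 ≤ m) [Fact (1 < m)]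
    (f : G →g SimpleGraph.circulantGraph ({1} : Set (ZMod m))) (hk : ¬ G.Colorable 2)
    (hinj : ∀ (f : G →g SimpleGraph.circulantGraph ({1} : Set (ZMod m))) (x y z : V),
      G.Adj z x → G.Adj z y → f x = f y → x = y) :
    Nonempty (G ≃g SimpleGraph.circulantGraph ({1} : Set (ZMod m))) := by
  have hne : NeZero m := ⟨by omega⟩
  have hboth : ∀ v, (∃ w, G.Adj v w ∧ f w = f v + 1) ∧ ∃ w, G.Adj v w ∧ f v = f w + 1 := by
    intro v
    obtain ⟨w, hw⟩ := exists_adj_of_not_colorable hG hk v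
    obtain ⟨u, huw, hu⟩ := exists_ne_adj_of_locallyInjective hG f hk hinj hw
    have hfne : f u ≠ f w := fun h => huw (hinj f _ _ _ hu hw h)
    rcases circulantGraph_one_adj.1 (f.map_adj hw) with h1 | h1 <;>
      rcases circulantGraph_one_adj.1 (f.map_adj hu) with h2 | h2
    · exact absurd (h2.trans h1.symm) hfne
    · exact ⟨⟨w, hw, h1⟩, u, hu, h2⟩
    · exact ⟨⟨u, hu, h2⟩, w, hw, h1⟩
    · exact absurd (add_right_cancel (h2.symm.trans h1)) hfne
  choose s hs hfs using fun v => (hboth v).1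
  have hsucc : ∀ a b, G.Adj a b → f b = f a + 1 → b = s a := fun a b hab h =>
    hinj f _ _ _ hab (hs a) (h.trans (hfs a).symm)
  have hadj : ∀ a b, G.Adj a b → b = s a ∨ a = s b := fun a b hab =>
    (circulantGraph_one_adj.1 (f.map_adj hab)).imp (hsucc a b hab) (hsucc b a hab.symm)
  have hsurj : Function.Surjective s := fun v => by
    obtain ⟨w, hw, h⟩ := (hboth v).2
    exact ⟨w, (hsucc w v hw.symm h).symm⟩
  have hper := iterate_eq_self_of_locallyInjective hm f hinj hs hfs hadj hsurj
  obtain ⟨v⟩ := hG.nonempty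
  have hall : ∀ b, ∃ i, b = s^[i] v := by
    refine mem_of_connected_of_adj_closed hG ?_ (⟨0, rfl⟩ : ∃ i, v = s^[i] v)
    rintro a b hab ⟨i, rfl⟩
    rcases hadj _ _ hab with rfl | h
    · exact ⟨i + 1, by rw [Function.iterate_succ_apply']⟩
    · refine ⟨m - 1 + i, ?_⟩
      rw [Function.iterate_add_apply, h, ← Function.iterate_succ_apply,
        show (m - 1).succ = m by omega, hper]
  have hfi : ∀ i, f (s^[i] v) = f v + i := by
    intro i
    induction i with
    | zero => simp
    | succ i ih => rw [Function.iterate_succ_apply', hfs, ih]; push_cast; ring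
  have hfinj : Function.Injective f := by
    intro a b h
    obtain ⟨i, rfl⟩ := hall a
    obtain ⟨j, rfl⟩ := hall b
    rw [hfi, hfi, add_right_inj, ZMod.natCast_eq_natCast_iff'] at h
    have hp : Function.IsPeriodicPt s m v := hper v
    rw [← hp.iterate_mod_apply i, h, hp.iterate_mod_apply]
  have hfsurj : Function.Surjective f := fun y =>
    ⟨s^[(y - f v).val] v, by rw [hfi, ZMod.natCast_zmod_val]; ring⟩
  refine ⟨⟨Equiv.ofBijective f ⟨hfinj, hfsurj⟩, fun {a b} => ⟨fun h => ?_, fun h => f.map_adj h⟩⟩⟩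
  rcases circulantGraph_one_adj.1 h with h | h
  · have : b = s a := hfinj (h.trans (hfs a).symm)
    exact this ▸ hs a
  · have : a = s b := hfinj (h.trans (hfs b).symm)
    exact this ▸ (hs b).symm

theorem nonempty_circularClique_iso_circulantGraph {q : ℕ} (hq : 0 < q) :
    Nonempty (circularClique (2 * q + 1) q ≃g
      SimpleGraph.circulantGraph ({1} : Set (ZMod (2 * q + 1)))) := by
  have hF : Fact (1 < 2 * q + 1) := ⟨by omega⟩
  have h2q : (2 * q + 1 : ZMod (2 * q + 1)) = 0 := by exact_mod_cast ZMod.natCast_self (2 * q + 1)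
  -- Adjacent vertices differ by ±q modulo 2q+1, and -2 is the inverse of q.
  let φ : Fin (2 * q + 1) → ZMod (2 * q + 1) := fun a => -2 * ((a : ℕ) : ZMod (2 * q + 1))
  have hcast : ∀ a : Fin (2 * q + 1), ((a : ℕ) : ZMod (2 * q + 1)) = q * φ a := by
    intro a
    linear_combination ((a : ℕ) : ZMod (2 * q + 1)) * h2q
  have hφ : Function.Injective φ := by
    intro a b h
    have h' : ((a : ℕ) : ZMod (2 * q + 1)) = ((b : ℕ) : ZMod (2 * q + 1)) := by
      rw [hcast, hcast, h]
    rw [ZMod.natCast_eq_natCast_iff', Nat.mod_eq_of_lt a.2, Nat.mod_eq_of_lt b.2] at h'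
    exact Fin.ext h'
  have hbij : Function.Bijective φ := (Fintype.bijective_iff_injective_and_card φ).2
    ⟨hφ, by rw [ZMod.card, Fintype.card_fin]⟩
  have hstep : ∀ a b : Fin (2 * q + 1), φ b = φ a + 1 ↔
      (a : ℕ) + q = b ∨ (b : ℕ) + q + 1 = a := by
    intro a b
    have h1 : φ b = φ a + 1 ↔ (((a : ℕ) + q : ℕ) : ZMod (2 * q + 1)) = ((b : ℕ) : ZMod _) := by
      push_cast
      constructor
      · intro h
        rw [hcast, hcast b, h]
        ring
      · intro h
        simp only [φ]
        linear_combination 2 * h - h2q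
    rw [h1, ZMod.natCast_eq_natCast_iff', Nat.mod_eq_of_lt b.2]
    have := a.2
    rcases lt_or_ge ((a : ℕ) + q) (2 * q + 1) with h | h
    · rw [Nat.mod_eq_of_lt h]
      omega
    · rw [Nat.mod_eq_sub_mod h, Nat.mod_eq_of_lt (by omega)]
      omega
  refine ⟨⟨Equiv.ofBijective φ hbij, fun {a b} => ?_⟩⟩
  rw [Equiv.ofBijective_apply, Equiv.ofBijective_apply, circulantGraph_one_adj, hstep, hstep,
    circularClique_adj_iff hq]
  omega

/-! ### From χ_c to homomorphisms and colourability -/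

theorem nonempty_hom_of_mul {k p q : ℕ} (hk : 0 < k) (hq : 0 < q) :
    Nonempty (circularClique (k * p) (k * q) →g circularClique p q) := by
  refine ⟨⟨fun x => ⟨x / k, Nat.div_lt_of_lt_mul x.2⟩, fun {a b} hab => ?_⟩⟩
  have key : ∀ x y r s : ℕ, x + k * r ≤ y + k * s → x / k + r ≤ y / k + s := by
    intro x y r s h
    rw [← Nat.add_mul_div_left _ _ hk, ← Nat.add_mul_div_left _ _ hk]
    exact Nat.div_le_div_right h
  rw [circularClique_adj_iff (by positivity)] at hab
  rw [circularClique_adj_iff hq]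
  exact hab.imp (And.imp (fun h => key _ _ q 0 (by simpa using h)) (key _ _ _ _))
    (And.imp (fun h => key _ _ q 0 (by simpa using h)) (key _ _ _ _))

/-- The minimum may be attained by another representative of p/q; by coprimality it is (kp, kq), and
division by k finishes. -/
theorem IsCircularChromaticNumber.nonempty_hom {V : Type u} {G : SimpleGraph V} {p q : ℕ}
    (hq : 0 < q) (hcop : Nat.Coprime p q) (h : IsCircularChromaticNumber G ((p : ℚ) / q)) :
    Nonempty (G →g circularClique p q) := by
  obtain ⟨a, b, hb, -, hab, ⟨c⟩⟩ := h.1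
  have hmul : p * b = a * q := by
    rw [div_eq_div_iff (by positivity) (by positivity)] at hab
    exact_mod_cast hab
  obtain ⟨k, rfl⟩ : q ∣ b := hcop.symm.dvd_of_dvd_mul_left (hmul ▸ dvd_mul_left q a)
  have ha : a = k * p := by
    apply Nat.eq_of_mul_eq_mul_right hq
    rw [← hmul]
    ring
  subst ha
  rw [mul_comm q k] at c
  obtain ⟨g⟩ := nonempty_hom_of_mul (p := p) (Nat.pos_of_mul_pos_left hb) hq
  exact ⟨g.comp c⟩

theorem IsCircularChromaticNumber.not_colorable {V : Type u} {G : SimpleGraph V} {p q k : ℕ}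
    (hq : 0 < q) (hk : 0 < k) (hlt : k * q < p)
    (h : IsCircularChromaticNumber G ((p : ℚ) / q)) : ¬ G.Colorable k := by
  rintro ⟨c⟩
  have hle := h.2 ⟨k, 1, one_pos, hk, rfl, ⟨(circularClique_one k).symm ▸ c⟩⟩
  rw [div_le_div_iff₀ (by positivity) (by positivity)] at hle
  norm_cast at hle
  omega

theorem foldsTo_circularClique_one {p : ℕ} (hp : 2 ≤ p) {V : Type u} [Finite V]
    {G : SimpleGraph V} (hG : G.Connected)
    (h : IsCircularChromaticNumber G ((p : ℚ) / (1 : ℕ))) : FoldsTo G (circularClique p 1) := by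
  obtain ⟨f⟩ := h.nonempty_hom one_pos (Nat.coprime_one_right p)
  obtain ⟨k, rfl⟩ : ∃ k, p = k + 1 := ⟨p - 1, by omega⟩
  have hk := h.not_colorable one_pos (k := k) (by omega) (by omega)
  rw [circularClique_one] at f ⊢
  exact foldsTo_of_locallyInjective_imp_iso
    (fun _ _ _ hG f hk hinj => nonempty_iso_top_of_locallyInjective hG f hk hinj) V G hG f hk

theorem foldsTo_circularClique_odd {q : ℕ} (hq : 0 < q) {V : Type u} [Finite V]
    {G : SimpleGraph V} (hG : G.Connected)
    (h : IsCircularChromaticNumber G (((2 * q + 1 : ℕ) : ℚ) / q)) :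
    FoldsTo G (circularClique (2 * q + 1) q) := by
  obtain ⟨f⟩ := h.nonempty_hom hq (by simp)
  obtain ⟨e⟩ := nonempty_circularClique_iso_circulantGraph hq
  have _ : Fact (1 < 2 * q + 1) := ⟨by omega⟩
  refine foldsTo_of_locallyInjective_imp_iso (fun V _ G hG f hk hinj => ?_) V G hG f
    (h.not_colorable hq two_pos (by omega))
  obtain ⟨e'⟩ := nonempty_iso_circulantGraph_of_locallyInjective hG (by omega)
    (e.toHom.comp f) hk fun g x y z hx hy hg =>
      hinj (e.symm.toHom.comp g) x y z hx hy (congrArg e.symm hg)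
  exact ⟨e'.trans e.symm⟩

theorem mainTheorem8 (p q : ℕ) (hq : 0 < q) (hpq : 2 * q ≤ p) :
    ((q = 1 ∨ p = 2 * q + 1) →
      ∀ (V : Type u) [Finite V] (G : SimpleGraph V), G.Connected →
        IsCircularChromaticNumber G ((p : ℚ) / (q : ℚ)) → FoldsTo G (circularClique p q)) ∧
    (¬ (q = 1 ∨ p = 2 * q + 1) →
      ∃ (n : ℕ) (G : SimpleGraph (Fin n)), G.Connected ∧
        IsCircularChromaticNumber G ((p : ℚ) / (q : ℚ)) ∧ ¬ FoldsTo G (circularClique p q)) := by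
  refine ⟨?_, fun h => exists_connected_not_foldsTo (by omega) hpq (by omega)⟩
  rintro (rfl | rfl) V _ G hG h
  · exact foldsTo_circularClique_one hpq hG h
  · exact foldsTo_circularClique_odd hq hG h
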